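/- Let $L=5$ and let $\mathcal P_5$ be the probability simplex in $\mathbb R^5$. For $x,y\in\mathcal P_5$ put $\mu(x,y)=\sum_{k=1}^{5}x_k\bigl(\sum_{l=1}^{k}y_l-\tfrac12 y_k\bigr)$. For three arms with feedback distributions $P=(P^{(1)},P^{(2)},P^{(3)})\in\mathcal P_5^3$ the Borda score of arm $i$ is $B_i(P)=\tfrac12\sum_{j\ne i}\mu(P^{(i)},P^{(j)})$, and the Borda winner is the arm with the (strictly) largest Borda score. Pulling arm $a$ yields an independent feedback in $\{1,\dots,5\}$ with distribution $P^{(a)}$. If arm $1$ is the Borda winner, the Borda regret of the first $T$ rounds, in which arms $a_1,\dots,a_T$ are pulled, is $R_T=\sum_{t=1}^{T}\bigl(B_1(P)-B_{a_t}(P)\bigr)$. Consider Thompson Borda sampling with $P^{(1)}$ and $P^{(2)}$ known: in the first $3t_0$ rounds every arm is pulled $t_0$ times. In each later round, if $C_k$ is the number of times that feedback $k$ has been observed from arm $3$ so far, draw $\theta^{(3)}\sim\mathrm{Dir}(C_1+1,\dots,C_5+1)$ and pull an arm $i$ with the largest Borda score $B_i(P^{(1)},P^{(2)},\theta^{(3)})$,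 ties being broken by a fixed measurable rule depending on the three scores. Theorem. There exist $P^{(1)},P^{(2)},P^{(3)}\in\mathcal P_5$ such that arm $1$ is the Borda winner, and a constant $\eta>0$, such that for every $t_0\ge 0$ and every tie-breaking rule the following hold: (i) there is a constant $\xi\in(0,\infty)$ with $$\liminf_{T\to\infty}\frac{\mathbb E[R_T]}{T^{\eta}}=\xi ;$$ (ii) $\mathbb E[R_T]\ge T^{3/32-o(1)}$, that is, for every $\delta>0$ one has $\mathbb E[R_T]\ge T^{3/32-\delta}$ for all sufficiently large $T$. -/

import Mathlib

open Filter Topology MeasureTheory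

noncomputable section

namespace QDB

/-- The probability that an `x`-distributed feedback beats an independent `y`-distributed one,
ties counting one half. -/
def mu {L : ℕ} (x y : Fin L → ℝ) : ℝ :=
  ∑ k, x k * ((∑ l ∈ Finset.Iic k, y l) - 1 / 2 * y k)

/-- The Borda score of arm `i`: its average winning probability against the other arms. -/
def bordaScore {K L : ℕ} (P : Fin K → Fin L → ℝ) (i : Fin K) : ℝ :=
  1 / ((K : ℝ) - 1) * ∑ j ∈ Finset.univ.erase i, mu (P i) (P j)

/-- Arm `i` is the Borda winner: the unique maximizer of the Borda score. -/
def IsBordaWinner {K L : ℕ} (P : Fin K → Fin L → ℝ) (i : Fin K) : Prop :=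
  ∀ j, j ≠ i → bordaScore P j < bordaScore P i

/-- The gap in Borda score between the Borda winner `w` and arm `i`. -/
def bordaGap {K L : ℕ} (P : Fin K → Fin L → ℝ) (w i : Fin K) : ℝ :=
  bordaScore P w - bordaScore P i

/-- The Dirichlet density with respect to Lebesgue measure in the first `m` coordinates; the last
coordinate of the point of the simplex is `1 - ∑ i, x i`. -/
def dirichletDensity {m : ℕ} (α : Fin (m + 1) → ℝ) (x : Fin m → ℝ) : ℝ :=
  Real.Gamma (∑ i, α i) / (∏ i, Real.Gamma (α i)) *
    ((∏ i : Fin m, x i ^ (α i.castSucc - 1)) * (1 - ∑ i, x i) ^ (α (Fin.last m) - 1))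

/-- The Dirichlet distribution, as a measure on `ℝ^(m+1)` carried by the probability simplex. -/
def dirichlet {m : ℕ} (α : Fin (m + 1) → ℝ) : Measure (Fin (m + 1) → ℝ) :=
  (((volume : Measure (Fin m → ℝ)).restrict {x | (∀ i, 0 ≤ x i) ∧ ∑ i, x i ≤ 1}).withDensity
    (fun x => ENNReal.ofReal (dirichletDensity α x))).map
    (fun x => (Fin.snoc x (1 - ∑ i, x i) : Fin (m + 1) → ℝ))

/-- The number of times feedback `k` was observed from arm `i` in the history `h`, whose entries
are the pairs (arm pulled, feedback received). -/
def count {K L n : ℕ} (h : Fin n → Fin K × Fin L) (i : Fin K) (k : Fin L) : ℕ :=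
  (Finset.univ.filter (fun s => h s = (i, k))).card

/-- A (measurable) choice of a maximizer, for every vector of scores. -/
structure IsArgmaxRule {K : ℕ} (sel : (Fin K → ℝ) → Fin K) : Prop where
  measurable : Measurable sel
  le_sel : ∀ (b : Fin K → ℝ) (i : Fin K), b i ≤ b (sel b)

/-- Thompson Borda sampling for three arms when the distributions of the first two are known:
the probability of pulling arm `i` in the next round, given the history `h` of the first `n` rounds.
In the first `3 * t0` rounds the arms are pulled in turn, `t0` times each. Afterwards `θ` is drawn
from the Dirichlet posterior of the third arm, and the arm of largest Borda score with respect to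
`(P 0, P 1, θ)` is pulled. -/
def pullProb {m : ℕ} (P : Fin 3 → Fin (m + 1) → ℝ) (t0 : ℕ) (sel : (Fin 3 → ℝ) → Fin 3)
    {n : ℕ} (h : Fin n → Fin 3 × Fin (m + 1)) (i : Fin 3) : ℝ :=
  if n < 3 * t0 then (if (i : ℕ) = n % 3 then 1 else 0)
  else (dirichlet (fun k => (count h 2 k : ℝ) + 1)).real
    {θ | sel (bordaScore ![P 0, P 1, θ]) = i}

/-- The probability of the history `h`: in each round the arm is drawn according to the algorithm
given the past, and then the feedback according to the true distribution of the arm. -/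
def historyProb {m : ℕ} (P : Fin 3 → Fin (m + 1) → ℝ) (t0 : ℕ) (sel : (Fin 3 → ℝ) → Fin 3)
    {T : ℕ} (h : Fin T → Fin 3 × Fin (m + 1)) : ℝ :=
  ∏ t : Fin T, pullProb P t0 sel (fun s : Fin t => h (Fin.castLE t.isLt.le s)) (h t).1 *
    P (h t).1 (h t).2

/-- The expected Borda regret of the first `T` rounds, where arm `w` is the Borda winner. -/
def expectedBordaRegret {m : ℕ} (P : Fin 3 → Fin (m + 1) → ℝ) (w : Fin 3) (t0 : ℕ)
    (sel : (Fin 3 → ℝ) → Fin 3) (T : ℕ) : ℝ :=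
  ∑ h : Fin T → Fin 3 × Fin (m + 1),
    historyProb P t0 sel h * ∑ t : Fin T, bordaGap P w (h t).1

end QDB

end

/-!
The third arm is the worst one, and the algorithm learns which of the first two arms is best only
through it. After `N` pulls of the third arm its posterior is a Dirichlet distribution all of whose
parameters are `1` except on the two lowest levels, where it concentrates. The set of `θ` on which
the second arm overtakes the first, and the set on which the third arm is best, are both cut off
from the probability simplex near its last vertex by hyperplanes. A simplex cut off at the last
vertex is a diagonal image of the whole one, so that its Dirichlet mass is exactly `∏ i, r i ^ a i`,
where `r i` is the scaling factor in coordinate `i` and `a i` the parameter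
(`prod_rpow_le_dirichlet`, `dirichlet_le_prod_rpow`). Hence the third arm is pulled with probability
of exact order `(14 / 33) ^ N` and a suboptimal arm with probability of exact order `(2 / 3) ^ N`,
without polynomial corrections: exploration dies out much faster than the mistakes do.

It remains to follow `N`. The expectation of `(33 / 14) ^ N` grows at most linearly in time
(`historyExp_inv_rate_le`), so by Jensen's inequality the expectation of `(2 / 3) ^ N` is at least
of order `T ^ (η - 1)`, where `(33 / 14) ^ (η - 1) = 2 / 3` (`rpow_le_historyExp`). Summing over the
rounds bounds the regret below by a multiple of `T ^ η`. Conversely the potential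
`(11 / 7) ^ N = (33 / 14) ^ (η * N)` increases in each round by at least a multiple of the
expectation of `(2 / 3) ^ N`, that is, of the regret of that round (`sum_historyExp_le`), and its
expectation is at most of order `T ^ η`, by Jensen's inequality again. Therefore the regret lies
between two multiples of `T ^ η`. As `(11 / 7) ^ 2 > 33 / 14`, the exponent `η` exceeds `1 / 2`, and
so the second claim follows from the lower bound.
-/

noncomputable section

/-! ### Dirichlet masses of scaled simplices -/

namespace QDB

section Simplex

variable {ι : Type*} [Fintype ι]

/-- The interior part of the simplex cut off from the positive orthant by the hyperplane that meets
the `i`-th coordinate axis at `r i`; the slanted face is included. -/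
def cornerSimplex (r : ι → ℝ) : Set (ι → ℝ) := {x | (∀ i, 0 < x i) ∧ ∑ i, x i / r i ≤ 1}

lemma measurableSet_cornerSimplex (r : ι → ℝ) : MeasurableSet (cornerSimplex r) := by
  unfold cornerSimplex
  measurability

/-- The integral of the Dirichlet kernel over `cornerSimplex r` scales multiplicatively in each
coordinate, because the simplex is a diagonal image of the standard one. -/
lemma lintegral_cornerSimplex_eq_mul {r a : ι → ℝ} (hr : ∀ i, 0 < r i) :
    ∫⁻ x in cornerSimplex r, ENNReal.ofReal (∏ i, x i ^ (a i - 1)) =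
      ENNReal.ofReal (∏ i, r i ^ a i) *
        ∫⁻ x in cornerSimplex (fun _ : ι => (1 : ℝ)), ENNReal.ofReal (∏ i, x i ^ (a i - 1)) := by
  classical
  have hdet : Matrix.det (Matrix.diagonal r) = ∏ i, r i := Matrix.det_diagonal
  have hpos : 0 < ∏ i, r i := Finset.prod_pos fun i _ => hr i
  have hmap := Real.smul_map_diagonal_volume_pi (D := r) (by rw [hdet]; exact hpos.ne')
  have hmeas : Measurable (Matrix.toLin' (Matrix.diagonal r)) :=
    (LinearMap.continuous_on_pi _).measurable
  have hT : ∀ x : ι → ℝ, Matrix.toLin' (Matrix.diagonal r) x = fun i => r i * x i := by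
    intro x
    ext i
    simp [Matrix.mulVec_diagonal]
  have hpre : Matrix.toLin' (Matrix.diagonal r) ⁻¹' cornerSimplex r =
      cornerSimplex (fun _ : ι => (1 : ℝ)) := by
    ext x
    simp only [Set.mem_preimage, cornerSimplex, Set.mem_ofPred_eq, hT, div_one]
    refine and_congr (forall_congr' fun i => by simp [hr i]) ?_
    rw [Finset.sum_congr rfl fun i _ => mul_div_cancel_left₀ (x i) (hr i).ne']
  conv_lhs => rw [← hmap]
  rw [Measure.restrict_smul, lintegral_smul_measure,
    setLIntegral_map (measurableSet_cornerSimplex r) (by fun_prop) hmeas, hpre, hdet, smul_eq_mul,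
    abs_of_pos hpos]
  have hcongr : ∀ x ∈ cornerSimplex (fun _ : ι => (1 : ℝ)),
      ENNReal.ofReal (∏ i, (Matrix.toLin' (Matrix.diagonal r) x) i ^ (a i - 1)) =
        ENNReal.ofReal (∏ i, r i ^ (a i - 1)) * ENNReal.ofReal (∏ i, x i ^ (a i - 1)) := by
    intro x hx
    rw [← ENNReal.ofReal_mul (Finset.prod_nonneg fun i _ => Real.rpow_nonneg (hr i).le _),
      ← Finset.prod_mul_distrib, hT]
    refine congrArg ENNReal.ofReal (Finset.prod_congr rfl fun i _ => ?_)
    exact Real.mul_rpow (hr i).le (hx.1 i).le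
  rw [setLIntegral_congr_fun (measurableSet_cornerSimplex _) hcongr,
    lintegral_const_mul _ (by fun_prop), ← mul_assoc, ← ENNReal.ofReal_mul hpos.le,
    ← Finset.prod_mul_distrib,
    Finset.prod_congr rfl fun i _ => show r i * r i ^ (a i - 1) = r i ^ a i by
      rw [Real.rpow_sub_one (hr i).ne', mul_div_cancel₀ _ (hr i).ne']]

lemma lintegral_Ioi_rpow_mul_exp {s : ℝ} (hs : 0 < s) :
    ∫⁻ t in Set.Ioi (0 : ℝ), ENNReal.ofReal (Real.exp (-t) * t ^ (s - 1)) =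
      ENNReal.ofReal (Real.Gamma s) := by
  rw [Real.Gamma_eq_integral hs, ofReal_integral_eq_lintegral_ofReal
    (Real.GammaIntegral_convergent hs)]
  filter_upwards [ae_restrict_mem measurableSet_Ioi] with t ht
  exact mul_nonneg (Real.exp_pos _).le (Real.rpow_nonneg (le_of_lt ht) _)

lemma lintegral_pos_prod_rpow_mul_exp {a : ι → ℝ} (ha : ∀ i, 0 < a i) :
    ∫⁻ x in {x : ι → ℝ | ∀ i, 0 < x i}, ENNReal.ofReal (Real.exp (-∑ i, x i) *
      ∏ i, x i ^ (a i - 1)) = ENNReal.ofReal (∏ i, Real.Gamma (a i)) := by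
  have hms : MeasurableSet {x : ι → ℝ | ∀ i, 0 < x i} := by measurability
  let g : ι → ℝ → ℝ := fun i => (Set.Ioi 0).indicator fun t => Real.exp (-t) * t ^ (a i - 1)
  have hgi : ∀ i, Integrable (g i) := fun i =>
    (integrable_indicator_iff measurableSet_Ioi).2 (Real.GammaIntegral_convergent (ha i))
  have hg0 : ∀ i t, 0 ≤ g i t := fun i t =>
    Set.indicator_nonneg (fun t ht => mul_nonneg (Real.exp_pos _).le
      (Real.rpow_nonneg (le_of_lt ht) _)) t
  have hint : ∫ x : ι → ℝ, ∏ i, g i (x i) = ∏ i, Real.Gamma (a i) := by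
    rw [integral_fintype_prod_volume_eq_prod]
    refine Finset.prod_congr rfl fun i _ => ?_
    rw [integral_indicator measurableSet_Ioi, Real.Gamma_eq_integral (ha i)]
  have hI : Integrable (fun x : ι → ℝ => ∏ i, g i (x i)) volume := Integrable.fintype_prod hgi
  rw [← hint, ofReal_integral_eq_lintegral_ofReal hI
    (ae_of_all _ fun x => Finset.prod_nonneg fun i _ => hg0 i _), ← lintegral_indicator hms]
  refine lintegral_congr fun x => ?_
  by_cases hx : ∀ i, 0 < x i
  · rw [Set.indicator_of_mem (show x ∈ {x : ι → ℝ | ∀ i, 0 < x i} from hx),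
      ← Finset.sum_neg_distrib, Real.exp_sum, ← Finset.prod_mul_distrib]
    congr 1
    refine Finset.prod_congr rfl fun i _ => ?_
    simp only [g, Set.indicator, Set.mem_Ioi, hx i, if_true]
  · rw [Set.indicator_of_notMem (show x ∉ {x : ι → ℝ | ∀ i, 0 < x i} from hx)]
    push Not at hx
    obtain ⟨i, hi⟩ := hx
    have hgi0 : g i (x i) = 0 := Set.indicator_of_notMem (by simpa using hi) _
    rw [Finset.prod_eq_zero (Finset.mem_univ i) hgi0, ENNReal.ofReal_zero]

lemma lintegral_Ioi_indicator_exp {s : ℝ} (hs : 0 < s) :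
    ∫⁻ t in Set.Ioi (0 : ℝ), (Set.Ici s).indicator (fun t => ENNReal.ofReal (Real.exp (-t))) t =
      ENNReal.ofReal (Real.exp (-s)) := by
  rw [lintegral_indicator measurableSet_Ici, Measure.restrict_restrict measurableSet_Ici,
    Set.inter_eq_left.2 (Set.Ici_subset_Ioi.2 hs), ← restrict_Ioi_eq_restrict_Ici,
    ← ofReal_integral_eq_lintegral_ofReal (integrableOn_exp_neg_Ioi s)
      (ae_of_all _ fun _ => (Real.exp_pos _).le), integral_exp_neg_Ioi]

/-- Dirichlet's integral. Integrating the kernel against `exp (-t)` over `∑ i, x i ≤ t` in the two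
possible orders gives a product of Gamma integrals on the one hand, and the integral over the
standard simplex times a Gamma integral on the other. -/
lemma Gamma_mul_lintegral_cornerSimplex_one [Nonempty ι] {a : ι → ℝ} (ha : ∀ i, 0 < a i) :
    ENNReal.ofReal (Real.Gamma (∑ i, a i + 1)) *
      ∫⁻ x in cornerSimplex (fun _ : ι => (1 : ℝ)), ENNReal.ofReal (∏ i, x i ^ (a i - 1)) =
      ENNReal.ofReal (∏ i, Real.Gamma (a i)) := by
  have hms : MeasurableSet {x : ι → ℝ | ∀ i, 0 < x i} := by measurability
  have hsum : 0 < ∑ i, a i := Finset.sum_pos (fun i _ => ha i) Finset.univ_nonempty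
  let S : Set ((ι → ℝ) × ℝ) := {p | ∑ i, p.1 i ≤ p.2}
  have hS : MeasurableSet S := by
    apply measurableSet_le <;> fun_prop
  let F : (ι → ℝ) × ℝ → ENNReal := S.indicator fun p =>
    ENNReal.ofReal (∏ i, p.1 i ^ (a i - 1)) * ENNReal.ofReal (Real.exp (-p.2))
  have hF : Measurable F := Measurable.indicator (by fun_prop) hS
  have hswap := lintegral_lintegral_swap (μ := volume.restrict {x : ι → ℝ | ∀ i, 0 < x i})
    (ν := volume.restrict (Set.Ioi (0 : ℝ))) (f := fun x t => F (x, t)) hF.aemeasurable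
  have h1 : ∫⁻ x in {x : ι → ℝ | ∀ i, 0 < x i}, ∫⁻ t in Set.Ioi (0 : ℝ), F (x, t) =
      ENNReal.ofReal (∏ i, Real.Gamma (a i)) := by
    rw [← lintegral_pos_prod_rpow_mul_exp ha]
    refine setLIntegral_congr_fun hms fun x hx => ?_
    have hx0 : 0 < ∑ i, x i := Finset.sum_pos (fun i _ => hx i) Finset.univ_nonempty
    have : ∀ t, F (x, t) = ENNReal.ofReal (∏ i, x i ^ (a i - 1)) *
        (Set.Ici (∑ i, x i)).indicator (fun t => ENNReal.ofReal (Real.exp (-t))) t := by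
      intro t
      by_cases h : ∑ i, x i ≤ t
      · simp [F, S, Set.indicator, h]
      · simp [F, S, Set.indicator, h]
    simp only [this]
    rw [lintegral_const_mul _ (Measurable.indicator (by fun_prop) measurableSet_Ici),
      lintegral_Ioi_indicator_exp hx0, mul_comm, ENNReal.ofReal_mul (Real.exp_pos _).le]
  have h2 : ∫⁻ t in Set.Ioi (0 : ℝ), ∫⁻ x in {x : ι → ℝ | ∀ i, 0 < x i}, F (x, t) =
      ENNReal.ofReal (Real.Gamma (∑ i, a i + 1)) *
      ∫⁻ x in cornerSimplex (fun _ : ι => (1 : ℝ)), ENNReal.ofReal (∏ i, x i ^ (a i - 1)) := by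
    rw [← lintegral_Ioi_rpow_mul_exp (by positivity), ← lintegral_mul_const _ (by fun_prop)]
    refine setLIntegral_congr_fun measurableSet_Ioi fun t (ht : 0 < t) => ?_
    have hset : {x : ι → ℝ | ∑ i, x i ≤ t} ∩ {x : ι → ℝ | ∀ i, 0 < x i} =
        cornerSimplex fun _ => t := by
      ext x
      simp only [cornerSimplex, Set.mem_inter_iff, Set.mem_ofPred_eq, ← Finset.sum_div,
        div_le_one ht, and_comm]
    have hmt : MeasurableSet {x : ι → ℝ | ∑ i, x i ≤ t} := by
      apply measurableSet_le <;> fun_prop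
    have : ∀ x, F (x, t) = {x : ι → ℝ | ∑ i, x i ≤ t}.indicator
        (fun x => ENNReal.ofReal (∏ i, x i ^ (a i - 1)) * ENNReal.ofReal (Real.exp (-t))) x := by
      intro x
      simp [F, S, Set.indicator]
    simp only [this]
    rw [lintegral_indicator hmt, Measure.restrict_restrict hmt, hset,
      lintegral_mul_const _ (by fun_prop), lintegral_cornerSimplex_eq_mul fun _ => ht,
      add_sub_cancel_right, ENNReal.ofReal_mul (Real.exp_pos _).le, Real.rpow_sum_of_pos ht]
    ring
  rw [← h2, ← hswap, h1]

end Simplex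

variable {m : ℕ}

lemma volume_restrict_simplex_eq :
    (volume : Measure (Fin m → ℝ)).restrict {x | (∀ i, 0 ≤ x i) ∧ ∑ i, x i ≤ 1} =
      volume.restrict (cornerSimplex fun _ => 1) := by
  refine Measure.restrict_congr_set ?_
  have h : (Set.Ici (0 : Fin m → ℝ)) =ᵐ[volume] Set.pi Set.univ fun _ => Set.Ioi 0 :=
    (Measure.univ_pi_Ioi_ae_eq_Ici (f := fun _ : Fin m => (0 : ℝ))).symm
  have h2 := h.inter (ae_eq_refl {x : Fin m → ℝ | ∑ i, x i ≤ 1})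
  have e1 : {x : Fin m → ℝ | (∀ i, 0 ≤ x i) ∧ ∑ i, x i ≤ 1} =
      Set.Ici 0 ∩ {x | ∑ i, x i ≤ 1} := rfl
  have e2 : cornerSimplex (fun _ : Fin m => (1 : ℝ)) =
      (Set.pi Set.univ fun _ => Set.Ioi 0) ∩ {x | ∑ i, x i ≤ 1} := by
    ext x
    simp [cornerSimplex, Set.mem_pi]
  rw [e1, e2]
  exact h2

lemma measurable_snoc_one_sub :
    Measurable fun x : Fin m → ℝ => (Fin.snoc x (1 - ∑ i, x i) : Fin (m + 1) → ℝ) := by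
  refine measurable_pi_iff.2 fun i => ?_
  refine Fin.lastCases ?_ (fun j => ?_) i
  · simp only [Fin.snoc_last]
    fun_prop
  · simp only [Fin.snoc_castSucc]
    fun_prop

/-- When the last parameter is `1`, the Dirichlet density depends on the first coordinates only. -/
lemma dirichlet_apply {a : Fin (m + 1) → ℝ} (ha : ∀ i, 0 < a i) (hlast : a (Fin.last m) = 1)
    {A : Set (Fin (m + 1) → ℝ)} (hA : MeasurableSet A) :
    dirichlet a A = ENNReal.ofReal (Real.Gamma (∑ i, a i) / ∏ i, Real.Gamma (a i)) *
      ∫⁻ x in (fun x : Fin m → ℝ => (Fin.snoc x (1 - ∑ i, x i) : Fin (m + 1) → ℝ)) ⁻¹' A ∩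
        cornerSimplex (fun _ => 1), ENNReal.ofReal (∏ i, x i ^ (a i.castSucc - 1)) := by
  have hc : 0 ≤ Real.Gamma (∑ i, a i) / ∏ i, Real.Gamma (a i) :=
    div_nonneg (Real.Gamma_nonneg_of_nonneg (Finset.sum_nonneg fun i _ => (ha i).le))
      (Finset.prod_nonneg fun i _ => Real.Gamma_nonneg_of_nonneg (ha i).le)
  have hpre := measurable_snoc_one_sub hA
  rw [dirichlet, Measure.map_apply measurable_snoc_one_sub hA, withDensity_apply _ hpre,
    volume_restrict_simplex_eq, Measure.restrict_restrict hpre,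
    ← lintegral_const_mul _ (by fun_prop)]
  refine lintegral_congr fun x => ?_
  rw [dirichletDensity, hlast, sub_self, Real.rpow_zero, mul_one, ENNReal.ofReal_mul hc]

lemma dirichlet_normalization_mul [NeZero m] {a : Fin (m + 1) → ℝ} (ha : ∀ i, 0 < a i)
    (hlast : a (Fin.last m) = 1) {r : Fin m → ℝ} (hr : ∀ i, 0 < r i) :
    ENNReal.ofReal (Real.Gamma (∑ i, a i) / ∏ i, Real.Gamma (a i)) *
      ∫⁻ x in cornerSimplex r, ENNReal.ofReal (∏ i, x i ^ (a i.castSucc - 1)) =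
      ENNReal.ofReal (∏ i, r i ^ a i.castSucc) := by
  have hG : 0 < ∏ i : Fin m, Real.Gamma (a i.castSucc) :=
    Finset.prod_pos fun i _ => Real.Gamma_pos_of_pos (ha _)
  have key := Gamma_mul_lintegral_cornerSimplex_one (a := fun i : Fin m => a i.castSucc)
    fun i => ha _
  rw [lintegral_cornerSimplex_eq_mul hr, Fin.sum_univ_castSucc, Fin.prod_univ_castSucc, hlast,
    Real.Gamma_one, mul_one, ENNReal.ofReal_div_of_pos hG, ← key, mul_left_comm,
    ENNReal.div_eq_inv_mul, mul_assoc, ENNReal.inv_mul_cancel, mul_one]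
  · rw [key]
    simpa using hG
  · rw [key]
    exact ENNReal.ofReal_ne_top

lemma cornerSimplex_mono {ι : Type*} [Fintype ι] {r s : ι → ℝ} (hr : ∀ i, 0 < r i)
    (h : ∀ i, r i ≤ s i) : cornerSimplex r ⊆ cornerSimplex s := fun _ hx =>
  ⟨hx.1, (Finset.sum_le_sum fun i _ => div_le_div_of_nonneg_left (hx.1 i).le (hr i) (h i)).trans
    hx.2⟩

lemma isProbabilityMeasure_dirichlet [NeZero m] {a : Fin (m + 1) → ℝ}
    (ha : ∀ i, 0 < a i) (hlast : a (Fin.last m) = 1) :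
    IsProbabilityMeasure (dirichlet a) := by
  refine ⟨?_⟩
  rw [dirichlet_apply ha hlast MeasurableSet.univ, Set.preimage_univ, Set.univ_inter,
    dirichlet_normalization_mul ha hlast fun _ => one_pos]
  simp

/-- A set that contains a scaled simplex at the last vertex has at least its Dirichlet mass. -/
lemma prod_rpow_le_dirichlet [NeZero m] {a : Fin (m + 1) → ℝ} (ha : ∀ i, 0 < a i)
    (hlast : a (Fin.last m) = 1) {A : Set (Fin (m + 1) → ℝ)} (hA : MeasurableSet A)
    {r : Fin m → ℝ} (hr : ∀ i, 0 < r i) (hr1 : ∀ i, r i ≤ 1)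
    (h : ∀ x ∈ cornerSimplex r, (Fin.snoc x (1 - ∑ i, x i) : Fin (m + 1) → ℝ) ∈ A) :
    ENNReal.ofReal (∏ i, r i ^ a i.castSucc) ≤ dirichlet a A := by
  rw [dirichlet_apply ha hlast hA, ← dirichlet_normalization_mul ha hlast hr]
  gcongr
  exact fun x hx => ⟨h _ hx, cornerSimplex_mono hr hr1 hx⟩

/-- A set that meets the simplex inside a scaled simplex at the last vertex has at most the mass
`∏ i, r i ^ a i`, even if the scaled simplex leaves the probability simplex. -/
lemma dirichlet_le_prod_rpow [NeZero m] {a : Fin (m + 1) → ℝ} (ha : ∀ i, 0 < a i)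
    (hlast : a (Fin.last m) = 1) {A : Set (Fin (m + 1) → ℝ)} (hA : MeasurableSet A)
    {r : Fin m → ℝ} (hr : ∀ i, 0 < r i)
    (h : ∀ x ∈ cornerSimplex (fun _ : Fin m => (1 : ℝ)),
      (Fin.snoc x (1 - ∑ i, x i) : Fin (m + 1) → ℝ) ∈ A → x ∈ cornerSimplex r) :
    dirichlet a A ≤ ENNReal.ofReal (∏ i, r i ^ a i.castSucc) := by
  rw [dirichlet_apply ha hlast hA, ← dirichlet_normalization_mul ha hlast hr]
  gcongr
  exact fun x hx => h x hx.2 hx.1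

end QDB

/-! ### The instance and its pull probabilities -/

namespace QDB

/-- The feedback distributions. Arm `2` only produces the two lowest levels, on which neither of the
other arms puts any mass, so that the Borda scores do not distinguish these two levels. The mass
`6 / 13` of arm `1` on the top level is slightly below one half: arm `1` nearly ties with arm `0`
and overtakes it as soon as arm `2` is believed to reach the top level often enough. -/
def slowArms : Fin 3 → Fin 5 → ℝ :=
  ![![0, 0, 0, 1, 0], ![0, 0, 7 / 13, 0, 6 / 13], ![1 / 2, 1 / 2, 0, 0, 0]]

lemma mu_fin_five (x y : Fin 5 → ℝ) :
    mu x y = x 0 * (1 / 2 * y 0) + x 1 * (y 0 + 1 / 2 * y 1) + x 2 * (y 0 + y 1 + 1 / 2 * y 2) +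
      x 3 * (y 0 + y 1 + y 2 + 1 / 2 * y 3) + x 4 * (y 0 + y 1 + y 2 + y 3 + 1 / 2 * y 4) := by
  have h0 : Finset.Iic (0 : Fin 5) = {0} := by decide
  have h1 : Finset.Iic (1 : Fin 5) = {0, 1} := by decide
  have h2 : Finset.Iic (2 : Fin 5) = {0, 1, 2} := by decide
  have h3 : Finset.Iic (3 : Fin 5) = {0, 1, 2, 3} := by decide
  have h4 : Finset.Iic (4 : Fin 5) = {0, 1, 2, 3, 4} := by decide
  rw [mu, Fin.sum_univ_five, h0, h1, h2, h3, h4]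
  simp
  ring

lemma bordaScore_fin_three (P : Fin 3 → Fin 5 → ℝ) :
    bordaScore P 0 = 1 / 2 * (mu (P 0) (P 1) + mu (P 0) (P 2)) ∧
    bordaScore P 1 = 1 / 2 * (mu (P 1) (P 0) + mu (P 1) (P 2)) ∧
    bordaScore P 2 = 1 / 2 * (mu (P 2) (P 0) + mu (P 2) (P 1)) := by
  have h0 : Finset.univ.erase (0 : Fin 3) = {1, 2} := by decide
  have h1 : Finset.univ.erase (1 : Fin 3) = {0, 2} := by decide
  have h2 : Finset.univ.erase (2 : Fin 3) = {0, 1} := by decide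
  refine ⟨?_, ?_, ?_⟩ <;> simp only [bordaScore, h0, h1, h2] <;>
    rw [Finset.sum_pair (by decide)] <;> norm_num

lemma slowArms_mem_stdSimplex (i : Fin 3) : slowArms i ∈ stdSimplex ℝ (Fin 5) := by
  refine ⟨fun k => ?_, ?_⟩
  · fin_cases i <;> fin_cases k <;> norm_num [slowArms]
  · rw [Fin.sum_univ_five]
    fin_cases i <;>
      simp only [slowArms, Fin.zero_eta, Fin.mk_one, Fin.reduceFinMk, Matrix.cons_val] <;> norm_num

lemma isBordaWinner_slowArms : IsBordaWinner slowArms 0 := by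
  obtain ⟨h0, h1, h2⟩ := bordaScore_fin_three slowArms
  intro j hj
  fin_cases j
  · exact absurd rfl hj
  · change bordaScore slowArms 1 < _
    rw [h0, h1]
    simp only [mu_fin_five, slowArms, Matrix.cons_val]
    norm_num
  · change bordaScore slowArms 2 < _
    rw [h0, h2]
    simp only [mu_fin_five, slowArms, Matrix.cons_val]
    norm_num

/-- The Borda scores when the third arm has distribution `θ`. -/
def slowScore (θ : Fin 5 → ℝ) : Fin 3 → ℝ := bordaScore ![slowArms 0, slowArms 1, θ]

lemma measurable_slowScore : Measurable slowScore := by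
  refine measurable_pi_iff.2 fun i => ?_
  fin_cases i
  · simp only [slowScore, Fin.zero_eta, (bordaScore_fin_three _).1, mu_fin_five, Matrix.cons_val]
    fun_prop
  · simp only [slowScore, Fin.mk_one, (bordaScore_fin_three _).2.1, mu_fin_five, Matrix.cons_val]
    fun_prop
  · simp only [slowScore, Fin.reduceFinMk, (bordaScore_fin_three _).2.2, mu_fin_five,
      Matrix.cons_val]
    fun_prop

/-- The comparisons between the scores, in the first four coordinates of the simplex. -/
lemma slowScore_sub (x : Fin 4 → ℝ) :
    let b := slowScore (Fin.snoc x (1 - ∑ i, x i))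
    2 * (b 1 - b 0) = 2 / 13 - 3 / 13 * x 0 - 3 / 13 * x 1 - 1 / 2 * x 2 - 7 / 26 * x 3 ∧
    2 * (b 2 - b 1) = 14 / 13 - 33 / 13 * x 0 - 33 / 13 * x 1 - 2 * x 2 - 25 / 26 * x 3 ∧
    2 * (b 2 - b 0) = 16 / 13 - 36 / 13 * x 0 - 36 / 13 * x 1 - 5 / 2 * x 2 - 16 / 13 * x 3 := by
  intro b
  have e0 : (Fin.snoc x (1 - ∑ i, x i) : Fin 5 → ℝ) 0 = x 0 := Fin.snoc_castSucc (i := 0) ..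
  have e1 : (Fin.snoc x (1 - ∑ i, x i) : Fin 5 → ℝ) 1 = x 1 := Fin.snoc_castSucc (i := 1) ..
  have e2 : (Fin.snoc x (1 - ∑ i, x i) : Fin 5 → ℝ) 2 = x 2 := Fin.snoc_castSucc (i := 2) ..
  have e3 : (Fin.snoc x (1 - ∑ i, x i) : Fin 5 → ℝ) 3 = x 3 := Fin.snoc_castSucc (i := 3) ..
  have e4 : (Fin.snoc x (1 - ∑ i, x i) : Fin 5 → ℝ) 4 = 1 - (x 0 + x 1 + x 2 + x 3) := by
    rw [← Fin.sum_univ_four]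
    exact Fin.snoc_last ..
  simp only [b, slowScore, bordaScore_fin_three, mu_fin_five, slowArms, Matrix.cons_val, e0, e1, e2,
    e3, e4]
  refine ⟨?_, ?_, ?_⟩ <;> ring

section Pull

variable {t0 n : ℕ} {sel : (Fin 3 → ℝ) → Fin 3} {h : Fin n → Fin 3 × Fin 5}

lemma measurableSet_sel (hsel : IsArgmaxRule sel) (s : Set (Fin 3)) :
    MeasurableSet {θ | sel (slowScore θ) ∈ s} :=
  (hsel.measurable.comp measurable_slowScore) (Set.toFinite s).measurableSet

lemma pullProb_of_le (hn : 3 * t0 ≤ n) (i : Fin 3) :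
    pullProb slowArms t0 sel h i = (dirichlet fun k => (count h 2 k : ℝ) + 1).real
      {θ | sel (slowScore θ) = i} :=
  if_neg hn.not_gt

lemma prod_rpow_count (h2 : count h 2 2 = 0) (h3 : count h 2 3 = 0) {ρ s u : ℝ} (hρ : 0 < ρ) :
    ∏ i : Fin 4, (![ρ, ρ, s, u] : Fin 4 → ℝ) i ^ ((count h 2 i.castSucc : ℝ) + 1) =
      ρ ^ 2 * s * u * ρ ^ (count h 2 0 + count h 2 1) := by
  have e2 : count h 2 (Fin.castSucc (2 : Fin 4)) = 0 := h2
  have e3 : count h 2 (Fin.castSucc (3 : Fin 4)) = 0 := h3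
  have e0 : count h 2 (Fin.castSucc (0 : Fin 4)) = count h 2 0 := rfl
  have e1 : count h 2 (Fin.castSucc (1 : Fin 4)) = count h 2 1 := rfl
  rw [Fin.prod_univ_four, e0, e1, e2, e3]
  simp only [Matrix.cons_val, Nat.cast_zero, zero_add, Real.rpow_one]
  rw [Real.rpow_add_one hρ.ne', Real.rpow_add_one hρ.ne', Real.rpow_natCast, Real.rpow_natCast]
  ring

lemma count_add_one_pos (k : Fin 5) : (0 : ℝ) < (count h 2 k : ℝ) + 1 := by positivity

lemma isProbabilityMeasure_posterior (h4 : count h 2 4 = 0) :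
    IsProbabilityMeasure (dirichlet fun k : Fin 5 => (count h 2 k : ℝ) + 1) :=
  isProbabilityMeasure_dirichlet (m := 4) count_add_one_pos
    (show (count h 2 4 : ℝ) + 1 = 1 by simp [h4])

/-- The posterior of the third arm gives a set at least the mass of a simplex at the last vertex
that it contains, which depends on the history only through the number of pulls. -/
lemma le_posterior_real (h2 : count h 2 2 = 0) (h3 : count h 2 3 = 0) (h4 : count h 2 4 = 0)
    {A : Set (Fin 5 → ℝ)} (hA : MeasurableSet A) {ρ s u : ℝ} (hρ : 0 < ρ) (hs : 0 < s) (hu : 0 < u)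
    (hρ1 : ρ ≤ 1) (hs1 : s ≤ 1) (hu1 : u ≤ 1)
    (hsub : ∀ x ∈ cornerSimplex (![ρ, ρ, s, u] : Fin 4 → ℝ),
      (Fin.snoc x (1 - ∑ i, x i) : Fin 5 → ℝ) ∈ A) :
    ρ ^ 2 * s * u * ρ ^ (count h 2 0 + count h 2 1) ≤
      (dirichlet fun k : Fin 5 => (count h 2 k : ℝ) + 1).real A := by
  have hprob := isProbabilityMeasure_posterior h4
  have hr : ∀ i, 0 < (![ρ, ρ, s, u] : Fin 4 → ℝ) i := by
    intro i; fin_cases i <;> simpa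
  have hr1 : ∀ i, (![ρ, ρ, s, u] : Fin 4 → ℝ) i ≤ 1 := by
    intro i; fin_cases i <;> simpa
  have := prod_rpow_le_dirichlet (m := 4) count_add_one_pos
    (show (count h 2 4 : ℝ) + 1 = 1 by simp [h4]) hA hr hr1 hsub
  rw [← prod_rpow_count h2 h3 hρ]
  exact (ENNReal.ofReal_le_iff_le_toReal (measure_ne_top _ _)).1 this

/-- The posterior of the third arm gives a set at most the mass of a simplex at the last vertex that
it is contained in. -/
lemma posterior_real_le (h2 : count h 2 2 = 0) (h3 : count h 2 3 = 0) (h4 : count h 2 4 = 0)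
    {A : Set (Fin 5 → ℝ)} (hA : MeasurableSet A) {ρ s u : ℝ} (hρ : 0 < ρ) (hs : 0 < s) (hu : 0 < u)
    (hsub : ∀ x ∈ cornerSimplex (fun _ : Fin 4 => (1 : ℝ)),
      (Fin.snoc x (1 - ∑ i, x i) : Fin 5 → ℝ) ∈ A → x ∈ cornerSimplex ![ρ, ρ, s, u]) :
    (dirichlet fun k : Fin 5 => (count h 2 k : ℝ) + 1).real A ≤
      ρ ^ 2 * s * u * ρ ^ (count h 2 0 + count h 2 1) := by
  have hr : ∀ i, 0 < (![ρ, ρ, s, u] : Fin 4 → ℝ) i := by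
    intro i; fin_cases i <;> simpa
  have := dirichlet_le_prod_rpow (m := 4) count_add_one_pos
    (show (count h 2 4 : ℝ) + 1 = 1 by simp [h4]) hA hr hsub
  rw [← prod_rpow_count h2 h3 hρ]
  exact ENNReal.toReal_le_of_le_ofReal
    (Finset.prod_nonneg fun i _ => Real.rpow_nonneg (hr i).le _) this

lemma mem_cornerSimplex_vec {ρ s u : ℝ} {x : Fin 4 → ℝ} :
    x ∈ cornerSimplex ![ρ, ρ, s, u] ↔
      (∀ i, 0 < x i) ∧ x 0 / ρ + x 1 / ρ + x 2 / s + x 3 / u ≤ 1 := by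
  simp [cornerSimplex, Fin.sum_univ_four]

/-- The third arm can be best only beyond the hyperplane where it overtakes the second one, which
meets the edges from the last vertex to the first two at `14 / 33`. -/
lemma pullProb_two_le (hsel : IsArgmaxRule sel) (hn : 3 * t0 ≤ n) (h2 : count h 2 2 = 0)
    (h3 : count h 2 3 = 0) (h4 : count h 2 4 = 0) :
    pullProb slowArms t0 sel h 2 ≤ (14 / 33) ^ (count h 2 0 + count h 2 1) := by
  rw [pullProb_of_le hn]
  refine (posterior_real_le h2 h3 h4 (measurableSet_sel hsel {2}) (ρ := 14 / 33) (s := 7 / 13)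
    (u := 28 / 25) (by norm_num) (by norm_num) (by norm_num) fun x hx hmem => ?_).trans ?_
  · have hb := hsel.le_sel (slowScore (Fin.snoc x (1 - ∑ i, x i))) 1
    rw [show sel (slowScore (Fin.snoc x (1 - ∑ i, x i))) = 2 from hmem] at hb
    have := (slowScore_sub x).2.1
    refine mem_cornerSimplex_vec.2 ⟨hx.1, ?_⟩
    linarith
  · exact mul_le_of_le_one_left (by positivity) (by norm_num)

/-- Close to the edges from the last vertex to the first two, the third arm is best as soon as it
overtakes the second one. -/
lemma le_pullProb_two (hsel : IsArgmaxRule sel) (hn : 3 * t0 ≤ n) (h2 : count h 2 2 = 0)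
    (h3 : count h 2 3 = 0) (h4 : count h 2 4 = 0) :
    1 / 51 * (14 / 33) ^ (count h 2 0 + count h 2 1) ≤ pullProb slowArms t0 sel h 2 := by
  rw [pullProb_of_le hn]
  -- `1 / 3` is below the intercepts of both hyperplanes on the last two axes, so that the
  -- inequalities are strict.
  refine le_trans ?_ (le_posterior_real h2 h3 h4 (measurableSet_sel hsel {2}) (ρ := 14 / 33)
    (s := 1 / 3) (u := 1 / 3) (by norm_num) (by norm_num) (by norm_num) (by norm_num) (by norm_num)
    (by norm_num) fun x hx => ?_)
  · gcongr
    norm_num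
  · obtain ⟨hpos, hle⟩ := mem_cornerSimplex_vec.1 hx
    obtain ⟨-, h21, h20⟩ := slowScore_sub x
    have p0 := hpos 0
    have p1 := hpos 1
    have p2 := hpos 2
    have p3 := hpos 3
    have hb0 := hsel.le_sel (slowScore (Fin.snoc x (1 - ∑ i, x i))) 2
    change sel (slowScore (Fin.snoc x (1 - ∑ i, x i))) = 2
    generalize sel (slowScore (Fin.snoc x (1 - ∑ i, x i))) = j at hb0
    fin_cases j
    · simp only [Fin.zero_eta] at hb0
      linarith
    · simp only [Fin.mk_one] at hb0
      linarith
    · rfl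

/-- The second arm can be best only beyond the hyperplane where it overtakes the first one, which
meets the edges from the last vertex to the first two at `2 / 3`. -/
lemma pullProb_one_le (hsel : IsArgmaxRule sel) (hn : 3 * t0 ≤ n) (h2 : count h 2 2 = 0)
    (h3 : count h 2 3 = 0) (h4 : count h 2 4 = 0) :
    pullProb slowArms t0 sel h 1 ≤ (2 / 3) ^ (count h 2 0 + count h 2 1) := by
  rw [pullProb_of_le hn]
  refine (posterior_real_le h2 h3 h4 (measurableSet_sel hsel {1}) (ρ := 2 / 3) (s := 4 / 13)
    (u := 4 / 7) (by norm_num) (by norm_num) (by norm_num) fun x hx hmem => ?_).trans ?_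
  · have hb := hsel.le_sel (slowScore (Fin.snoc x (1 - ∑ i, x i))) 0
    rw [show sel (slowScore (Fin.snoc x (1 - ∑ i, x i))) = 1 from hmem] at hb
    have := (slowScore_sub x).1
    refine mem_cornerSimplex_vec.2 ⟨hx.1, ?_⟩
    linarith
  · exact mul_le_of_le_one_left (by positivity) (by norm_num)

/-- Beyond the hyperplane where the second arm overtakes the first, the first arm is not pulled. -/
lemma le_pullProb_one_add_two (hsel : IsArgmaxRule sel) (hn : 3 * t0 ≤ n) (h2 : count h 2 2 = 0)
    (h3 : count h 2 3 = 0) (h4 : count h 2 4 = 0) :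
    1 / 36 * (2 / 3) ^ (count h 2 0 + count h 2 1) ≤
      pullProb slowArms t0 sel h 1 + pullProb slowArms t0 sel h 2 := by
  have hprob := isProbabilityMeasure_posterior h4
  have hdisj : Disjoint {θ | sel (slowScore θ) = 1} {θ | sel (slowScore θ) = 2} :=
    Set.disjoint_left.2 fun θ h1 h2 => absurd (h1.symm.trans h2) (by decide)
  rw [pullProb_of_le hn, pullProb_of_le hn,
    ← measureReal_union hdisj (measurableSet_sel hsel {2})]
  refine le_trans ?_ (le_posterior_real h2 h3 h4
    ((measurableSet_sel hsel {1}).union (measurableSet_sel hsel {2})) (ρ := 2 / 3)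
    (s := 1 / 4) (u := 1 / 4) (by norm_num) (by norm_num) (by norm_num) (by norm_num) (by norm_num)
    (by norm_num) fun x hx => ?_)
  · gcongr
    norm_num
  -- `1 / 4` is below the intercepts `4 / 13` and `4 / 7`, so that the inequality is strict.
  · obtain ⟨hpos, hle⟩ := mem_cornerSimplex_vec.1 hx
    obtain ⟨h10, -, -⟩ := slowScore_sub x
    have p2 := hpos 2
    have p3 := hpos 3
    have hb := hsel.le_sel (slowScore (Fin.snoc x (1 - ∑ i, x i))) 1
    change sel (slowScore (Fin.snoc x (1 - ∑ i, x i))) = 1 ∨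
      sel (slowScore (Fin.snoc x (1 - ∑ i, x i))) = 2
    generalize sel (slowScore (Fin.snoc x (1 - ∑ i, x i))) = j at hb
    fin_cases j
    · simp only [Fin.zero_eta] at hb
      linarith
    · exact Or.inl rfl
    · exact Or.inr rfl

lemma sum_pullProb (hsel : IsArgmaxRule sel) (h4 : count h 2 4 = 0) :
    ∑ i, pullProb slowArms t0 sel h i = 1 := by
  by_cases hn : n < 3 * t0
  · have hi : ∀ i : Fin 3, pullProb slowArms t0 sel h i =
        if i = ⟨n % 3, Nat.mod_lt _ (by norm_num)⟩ then 1 else 0 := by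
      intro i
      simp [pullProb, hn, Fin.ext_iff]
    simp [hi]
  · have hprob := isProbabilityMeasure_posterior h4
    simp only [pullProb_of_le (not_lt.1 hn)]
    rw [← measureReal_biUnion_finset (f := fun i => {θ | sel (slowScore θ) = i})
      (fun i _ j _ hij => Set.disjoint_left.2 fun θ h1 h2 => hij (h1.symm.trans h2)) fun i _ => measurableSet_sel hsel {i}]
    have : (⋃ i ∈ Finset.univ, {θ | sel (slowScore θ) = i}) = Set.univ := by
      ext θ
      simp
    rw [this, probReal_univ]

lemma pullProb_nonneg {m : ℕ} (P : Fin 3 → Fin (m + 1) → ℝ) (h : Fin n → Fin 3 × Fin (m + 1))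
    (i : Fin 3) : 0 ≤ pullProb P t0 sel h i := by
  unfold pullProb
  split_ifs
  exacts [zero_le_one, le_rfl, measureReal_nonneg]

end Pull

end QDB

/-! ### Expectations over histories -/

namespace QDB

section General

variable {m : ℕ} (P : Fin 3 → Fin (m + 1) → ℝ) (t0 : ℕ) (sel : (Fin 3 → ℝ) → Fin 3)

/-- The expectation of a function of the history of the first `T` rounds. -/
def historyExp (T : ℕ) (F : (Fin T → Fin 3 × Fin (m + 1)) → ℝ) : ℝ :=
  ∑ h, historyProb P t0 sel h * F h

variable {P t0 sel} {T : ℕ}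

lemma historyProb_snoc (h : Fin T → Fin 3 × Fin (m + 1)) (x : Fin 3 × Fin (m + 1)) :
    historyProb P t0 sel (Fin.snoc h x : Fin (T + 1) → Fin 3 × Fin (m + 1)) =
      historyProb P t0 sel h * (pullProb P t0 sel h x.1 * P x.1 x.2) := by
  have key : ∀ (n : ℕ) (hn : n ≤ T) (hn' : n ≤ T + 1),
      (fun s : Fin n => (Fin.snoc h x : Fin (T + 1) → Fin 3 × Fin (m + 1)) (Fin.castLE hn' s)) =
        fun s : Fin n => h (Fin.castLE hn s) := by
    intro n hn hn'
    ext1 s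
    exact Fin.snoc_castSucc (α := fun _ => Fin 3 × Fin (m + 1)) x h (Fin.castLE hn s)
  unfold historyProb
  rw [Fin.prod_univ_castSucc]
  refine congrArg₂ (· * ·) (Finset.prod_congr rfl fun t _ => ?_) ?_
  · rw [Fin.snoc_castSucc (α := fun _ => Fin 3 × Fin (m + 1))]
    exact congrArg (· * _) (congrArg (fun g : Fin t → _ => pullProb P t0 sel g (h t).1)
      (key t t.isLt.le _))
  · rw [Fin.snoc_last (α := fun _ => Fin 3 × Fin (m + 1))]
    exact congrArg (· * _) (congrArg (fun g : Fin T → _ => pullProb P t0 sel g x.1)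
      (key T le_rfl _))

lemma historyExp_succ (F : (Fin (T + 1) → Fin 3 × Fin (m + 1)) → ℝ) :
    historyExp P t0 sel (T + 1) F = historyExp P t0 sel T fun h =>
      ∑ i, pullProb P t0 sel h i * ∑ k, P i k * F (Fin.snoc h (i, k)) := by
  unfold historyExp
  rw [← Equiv.sum_comp (Fin.snocEquiv fun _ => Fin 3 × Fin (m + 1)), Fintype.sum_prod_type_right]
  refine Finset.sum_congr rfl fun h _ => ?_
  rw [Fintype.sum_prod_type, Finset.mul_sum]
  refine Finset.sum_congr rfl fun i _ => ?_
  rw [Finset.mul_sum, Finset.mul_sum]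
  refine Finset.sum_congr rfl fun k _ => ?_
  change historyProb P t0 sel (Fin.snoc h (i, k) : Fin (T + 1) → Fin 3 × Fin (m + 1)) *
    F (Fin.snoc h (i, k)) = _
  rw [historyProb_snoc]
  ring

lemma historyProb_nonneg (hP : ∀ i k, 0 ≤ P i k) (h : Fin T → Fin 3 × Fin (m + 1)) :
    0 ≤ historyProb P t0 sel h :=
  Finset.prod_nonneg fun _ _ => mul_nonneg (pullProb_nonneg P _ _) (hP _ _)

lemma historyExp_mono (hP : ∀ i k, 0 ≤ P i k) {F G : (Fin T → Fin 3 × Fin (m + 1)) → ℝ}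
    (hFG : ∀ h, historyProb P t0 sel h ≠ 0 → F h ≤ G h) :
    historyExp P t0 sel T F ≤ historyExp P t0 sel T G := by
  refine Finset.sum_le_sum fun h _ => ?_
  by_cases h0 : historyProb P t0 sel h = 0
  · simp [h0]
  · exact mul_le_mul_of_nonneg_left (hFG h h0) (historyProb_nonneg hP h)

lemma historyExp_congr {F G : (Fin T → Fin 3 × Fin (m + 1)) → ℝ}
    (hFG : ∀ h, historyProb P t0 sel h ≠ 0 → F h = G h) :
    historyExp P t0 sel T F = historyExp P t0 sel T G := by
  refine Finset.sum_congr rfl fun h _ => ?_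
  by_cases h0 : historyProb P t0 sel h = 0
  · simp [h0]
  · rw [hFG h h0]

lemma historyExp_add (F G : (Fin T → Fin 3 × Fin (m + 1)) → ℝ) :
    historyExp P t0 sel T (fun h => F h + G h) =
      historyExp P t0 sel T F + historyExp P t0 sel T G := by
  simp [historyExp, mul_add, Finset.sum_add_distrib]

lemma historyExp_const_mul (c : ℝ) (F : (Fin T → Fin 3 × Fin (m + 1)) → ℝ) :
    historyExp P t0 sel T (fun h => c * F h) = c * historyExp P t0 sel T F := by
  simp only [historyExp, Finset.mul_sum]
  exact Finset.sum_congr rfl fun h _ => by ring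

lemma count_snoc (h : Fin T → Fin 3 × Fin (m + 1)) (x : Fin 3 × Fin (m + 1)) (i : Fin 3)
    (k : Fin (m + 1)) :
    count (Fin.snoc h x : Fin (T + 1) → Fin 3 × Fin (m + 1)) i k =
      count h i k + if x = (i, k) then 1 else 0 := by
  simp only [count, Finset.card_filter]
  rw [Fin.sum_univ_castSucc]
  simp only [Fin.snoc_castSucc (α := fun _ => Fin 3 × Fin (m + 1)),
    Fin.snoc_last (α := fun _ => Fin 3 × Fin (m + 1))]

lemma count_eq_zero_of_historyProb_ne_zero {h : Fin T → Fin 3 × Fin (m + 1)}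
    (hh : historyProb P t0 sel h ≠ 0) {i : Fin 3} {k : Fin (m + 1)} (hP : P i k = 0) :
    count h i k = 0 := by
  rw [count, Finset.card_eq_zero, Finset.filter_eq_empty_iff]
  intro t _ ht
  refine hh (Finset.prod_eq_zero (Finset.mem_univ t) ?_)
  rw [ht, hP, mul_zero]

end General

section SlowArms

variable {t0 T : ℕ} {sel : (Fin 3 → ℝ) → Fin 3}

/-- The number of pulls of the third arm, as far as they showed one of its two possible
feedbacks. -/
def pulls (h : Fin T → Fin 3 × Fin 5) : ℕ := count h 2 0 + count h 2 1

lemma slowArms_nonneg (i : Fin 3) (k : Fin 5) : 0 ≤ slowArms i k :=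
  (slowArms_mem_stdSimplex i).1 k

lemma count_two_eq_zero {h : Fin T → Fin 3 × Fin 5} (hh : historyProb slowArms t0 sel h ≠ 0) :
    count h 2 2 = 0 ∧ count h 2 3 = 0 ∧ count h 2 4 = 0 := by
  refine ⟨?_, ?_, ?_⟩ <;> exact count_eq_zero_of_historyProb_ne_zero hh (by simp [slowArms])

lemma historyExp_one (hsel : IsArgmaxRule sel) : ∀ T : ℕ,
    historyExp slowArms t0 sel T (fun _ => 1) = 1
  | 0 => by simp [historyExp, historyProb]
  | T + 1 => by
    rw [historyExp_succ]
    refine (historyExp_congr fun h hh => ?_).trans (historyExp_one hsel T)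
    simp only [mul_one, (slowArms_mem_stdSimplex _).2]
    exact sum_pullProb hsel (count_two_eq_zero hh).2.2

lemma pulls_snoc_of_ne {i : Fin 3} (hi : i ≠ 2) (h : Fin T → Fin 3 × Fin 5) (k : Fin 5) :
    pulls (Fin.snoc h (i, k) : Fin (T + 1) → Fin 3 × Fin 5) = pulls h := by
  simp [pulls, count_snoc, hi]

/-- One step of the process counting the pulls of the third arm. -/
lemma historyExp_pulls_succ (hsel : IsArgmaxRule sel) (G : ℕ → ℝ) :
    historyExp slowArms t0 sel (T + 1) (fun h => G (pulls h)) =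
      historyExp slowArms t0 sel T (fun h => G (pulls h)) +
        historyExp slowArms t0 sel T fun h =>
          pullProb slowArms t0 sel h 2 * (G (pulls h + 1) - G (pulls h)) := by
  rw [historyExp_succ, ← historyExp_add]
  refine historyExp_congr fun h hh => ?_
  have hsum := sum_pullProb (t0 := t0) hsel (count_two_eq_zero hh).2.2
  rw [Fin.sum_univ_three] at hsum
  have h2 : ∑ k, slowArms 2 k * G (pulls (Fin.snoc h (2, k) : Fin (T + 1) → Fin 3 × Fin 5)) =
      G (pulls h + 1) := by
    have e0 : pulls (Fin.snoc h (2, 0) : Fin (T + 1) → Fin 3 × Fin 5) = pulls h + 1 := by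
      simp [pulls, count_snoc]
      ring
    have e1 : pulls (Fin.snoc h (2, 1) : Fin (T + 1) → Fin 3 × Fin 5) = pulls h + 1 := by
      simp [pulls, count_snoc]
      ring
    rw [Fin.sum_univ_five, e0, e1]
    simp only [slowArms, Matrix.cons_val]
    ring
  rw [Fin.sum_univ_three, h2]
  simp only [pulls_snoc_of_ne (show (0 : Fin 3) ≠ 2 by decide),
    pulls_snoc_of_ne (show (1 : Fin 3) ≠ 2 by decide), ← Finset.sum_mul,
    (slowArms_mem_stdSimplex _).2]
  linear_combination G (pulls h) * hsum

lemma expectedBordaRegret_succ (hsel : IsArgmaxRule sel) (T : ℕ) :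
    expectedBordaRegret slowArms 0 t0 sel (T + 1) = expectedBordaRegret slowArms 0 t0 sel T +
      historyExp slowArms t0 sel T fun h =>
        ∑ i, pullProb slowArms t0 sel h i * bordaGap slowArms 0 i := by
  change historyExp slowArms t0 sel (T + 1) (fun h => ∑ t, bordaGap slowArms 0 (h t).1) =
    historyExp slowArms t0 sel T (fun h => ∑ t, bordaGap slowArms 0 (h t).1) + _
  rw [historyExp_succ, ← historyExp_add]
  refine historyExp_congr fun h hh => ?_
  have hsum := sum_pullProb (t0 := t0) hsel (count_two_eq_zero hh).2.2
  have hk : ∀ i : Fin 3, ∑ k, slowArms i k * ∑ t : Fin (T + 1), bordaGap slowArms 0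
      ((Fin.snoc h (i, k) : Fin (T + 1) → Fin 3 × Fin 5) t).1 =
      ∑ t, bordaGap slowArms 0 (h t).1 + bordaGap slowArms 0 i := by
    intro i
    simp only [Fin.sum_univ_castSucc (n := T), Fin.snoc_castSucc (α := fun _ => Fin 3 × Fin 5),
      Fin.snoc_last (α := fun _ => Fin 3 × Fin 5)]
    rw [← Finset.sum_mul, (slowArms_mem_stdSimplex i).2, one_mul]
  simp only [hk, mul_add, Finset.sum_add_distrib, ← Finset.sum_mul, hsum, one_mul]

end SlowArms

end QDB

/-! ### Growth of the regret -/

namespace QDB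

section Jensen

variable {m : ℕ} {P : Fin 3 → Fin (m + 1) → ℝ} {t0 T : ℕ} {sel : (Fin 3 → ℝ) → Fin 3}

/-- Jensen's inequality for the concave power `x ^ η`. -/
lemma historyExp_rpow_le (hP : ∀ i k, 0 ≤ P i k)
    (hone : historyExp P t0 sel T (fun _ => 1) = 1) {F : (Fin T → Fin 3 × Fin (m + 1)) → ℝ}
    (hF : ∀ h, 0 ≤ F h) {η : ℝ} (hη : 0 < η) (hη1 : η ≤ 1) :
    historyExp P t0 sel T (fun h => F h ^ η) ≤ historyExp P t0 sel T F ^ η := by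
  have hnn : 0 ≤ historyExp P t0 sel T fun h => F h ^ η :=
    Finset.sum_nonneg fun h _ => mul_nonneg (historyProb_nonneg hP h) (Real.rpow_nonneg (hF h) _)
  have key := Real.rpow_arith_mean_le_arith_mean_rpow Finset.univ
    (fun h => historyProb P t0 sel h) (fun h => F h ^ η) (fun h _ => historyProb_nonneg hP h)
    (by simpa [historyExp] using hone) (fun h _ => Real.rpow_nonneg (hF h) _)
    (p := η⁻¹) ((one_le_inv₀ hη).2 hη1)
  simp only [Real.rpow_rpow_inv (hF _) hη.ne'] at key
  calc historyExp P t0 sel T (fun h => F h ^ η)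
      = (historyExp P t0 sel T (fun h => F h ^ η) ^ η⁻¹) ^ η :=
        (Real.rpow_inv_rpow hnn hη.ne').symm
    _ ≤ _ := Real.rpow_le_rpow (Real.rpow_nonneg hnn _) key hη.le

/-- Jensen's inequality for the exponential function to the base `b`. -/
lemma rpow_historyExp_le (hP : ∀ i k, 0 ≤ P i k)
    (hone : historyExp P t0 sel T (fun _ => 1) = 1) {b : ℝ} (hb : 0 < b)
    (N : (Fin T → Fin 3 × Fin (m + 1)) → ℕ) :
    b ^ historyExp P t0 sel T (fun h => (N h : ℝ)) ≤ historyExp P t0 sel T fun h => b ^ N h := by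
  have := (convexOn_rpow_left hb).map_sum_le (t := Finset.univ)
    (w := fun h => historyProb P t0 sel h) (p := fun h => (N h : ℝ))
    (fun h _ => historyProb_nonneg hP h) (by simpa [historyExp] using hone)
    (fun _ _ => Set.mem_univ _)
  simpa [historyExp] using this

end Jensen

/-- The growth exponent of the regret: `14 / 33` and `2 / 3` are the rates at which the pull
probabilities of the third and second arm decay with the number of pulls of the third, and
`(14 / 33) ^ (1 - regretExponent) = 2 / 3`. -/
def regretExponent : ℝ := Real.log (11 / 7) / Real.log (33 / 14)

lemma log_rate_pos : 0 < Real.log (33 / 14) := Real.log_pos (by norm_num)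

lemma half_lt_regretExponent : 1 / 2 < regretExponent := by
  rw [regretExponent, lt_div_iff₀ log_rate_pos]
  have h : Real.log (33 / 14) < Real.log ((11 / 7) ^ 2) :=
    Real.log_lt_log (by norm_num) (by norm_num)
  rw [Real.log_pow] at h
  push_cast at h
  linarith

lemma regretExponent_lt_one : regretExponent < 1 := by
  rw [regretExponent, div_lt_one log_rate_pos]
  exact Real.log_lt_log (by norm_num) (by norm_num)

lemma regretExponent_pos : 0 < regretExponent :=
  lt_trans (by norm_num) half_lt_regretExponent

lemma rpow_regretExponent : (33 / 14 : ℝ) ^ regretExponent = 11 / 7 := by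
  rw [Real.rpow_def_of_pos (by norm_num), regretExponent, mul_div_cancel₀ _ log_rate_pos.ne',
    Real.exp_log (by norm_num)]

lemma rpow_regretExponent_sub_one : (33 / 14 : ℝ) ^ (regretExponent - 1) = 2 / 3 := by
  rw [Real.rpow_sub_one (by norm_num), rpow_regretExponent]
  norm_num

section Growth

variable {t0 : ℕ} {sel : (Fin 3 → ℝ) → Fin 3}

lemma bordaGap_slowArms : bordaGap slowArms 0 0 = 0 ∧ bordaGap slowArms 0 1 = 1 / 26 ∧
    bordaGap slowArms 0 2 = 10 / 13 := by
  obtain ⟨h0, h1, h2⟩ := bordaScore_fin_three slowArms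
  simp only [bordaGap, h0, h1, h2]
  simp only [mu_fin_five, slowArms, Matrix.cons_val]
  norm_num

/-- The expectation of the reciprocal `(33 / 14) ^ pulls` of the exploration rate increases by a
bounded amount in each round. -/
lemma historyExp_inv_rate_le (hsel : IsArgmaxRule sel) {T : ℕ} (hT : 3 * t0 ≤ T) :
    historyExp slowArms t0 sel T (fun h => (33 / 14) ^ pulls h) ≤
      historyExp slowArms t0 sel (3 * t0) (fun h => (33 / 14) ^ pulls h) + 2 * T := by
  induction T, hT using Nat.le_induction with
  | base => exact le_add_of_nonneg_right (by positivity)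
  | succ T hT ih =>
    have hstep : historyExp slowArms t0 sel T (fun h => pullProb slowArms t0 sel h 2 *
        ((33 / 14) ^ (pulls h + 1) - (33 / 14) ^ pulls h)) ≤ 2 := by
      calc _ ≤ historyExp slowArms t0 sel T (fun _ => 2 * 1) :=
            historyExp_mono slowArms_nonneg fun h hh => ?_
        _ = 2 := by rw [historyExp_const_mul, historyExp_one hsel, mul_one]
      obtain ⟨h2, h3, h4⟩ := count_two_eq_zero hh
      have hp : pullProb slowArms t0 sel h 2 ≤ (14 / 33) ^ pulls h :=
        pullProb_two_le hsel hT h2 h3 h4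
      have hq : (0 : ℝ) < (33 / 14) ^ pulls h := by positivity
      have hpq : (14 / 33 : ℝ) ^ pulls h * (33 / 14) ^ pulls h = 1 := by
        rw [← mul_pow]
        norm_num
      have := mul_le_mul_of_nonneg_right hp hq.le
      rw [hpq] at this
      rw [pow_succ]
      linarith
    rw [historyExp_pulls_succ hsel fun n => (33 / 14 : ℝ) ^ n]
    push_cast
    linarith

/-- The potential `(11 / 7) ^ pulls` increases in expectation by at least a constant multiple of the
expectation of `(2 / 3) ^ pulls`. -/
lemma sum_historyExp_le (hsel : IsArgmaxRule sel) {T : ℕ} (hT : 3 * t0 ≤ T) :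
    4 / 357 * ∑ t ∈ Finset.Ico (3 * t0) T,
      historyExp slowArms t0 sel t (fun h => (2 / 3) ^ pulls h) ≤
      historyExp slowArms t0 sel T fun h => (11 / 7) ^ pulls h := by
  induction T, hT using Nat.le_induction with
  | base =>
    simp only [Finset.Ico_self, Finset.sum_empty, mul_zero]
    exact Finset.sum_nonneg fun h _ =>
      mul_nonneg (historyProb_nonneg slowArms_nonneg h) (by positivity)
  | succ T hT ih =>
    have hstep : 4 / 357 * historyExp slowArms t0 sel T (fun h => (2 / 3) ^ pulls h) ≤
        historyExp slowArms t0 sel T (fun h => pullProb slowArms t0 sel h 2 *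
          ((11 / 7) ^ (pulls h + 1) - (11 / 7) ^ pulls h)) := by
      rw [← historyExp_const_mul]
      refine historyExp_mono slowArms_nonneg fun h hh => ?_
      obtain ⟨h2, h3, h4⟩ := count_two_eq_zero hh
      have hp : 1 / 51 * (14 / 33) ^ pulls h ≤ pullProb slowArms t0 sel h 2 :=
        le_pullProb_two hsel hT h2 h3 h4
      have hq : (0 : ℝ) < (11 / 7) ^ pulls h := by positivity
      have hpq : (14 / 33 : ℝ) ^ pulls h * (11 / 7) ^ pulls h = (2 / 3) ^ pulls h := by
        rw [← mul_pow]
        norm_num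
      have := mul_le_mul_of_nonneg_right hp hq.le
      rw [mul_assoc, hpq] at this
      rw [pow_succ]
      linarith
    rw [historyExp_pulls_succ hsel fun n => (11 / 7 : ℝ) ^ n, Finset.sum_Ico_succ_top hT, mul_add]
    linarith

lemma historyExp_potential_le (hsel : IsArgmaxRule sel) (T : ℕ) :
    historyExp slowArms t0 sel T (fun h => (11 / 7) ^ pulls h) ≤
      historyExp slowArms t0 sel T (fun h => (33 / 14) ^ pulls h) ^ regretExponent := by
  have := historyExp_rpow_le (F := fun h => (33 / 14) ^ pulls h) slowArms_nonneg
    (historyExp_one (t0 := t0) hsel T) (fun h => by positivity) regretExponent_pos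
    regretExponent_lt_one.le
  refine le_of_eq_of_le (congrArg _ (funext fun h => ?_)) this
  rw [← Real.rpow_natCast, ← Real.rpow_natCast, ← Real.rpow_mul (by norm_num), mul_comm,
    Real.rpow_mul (by norm_num), rpow_regretExponent]

/-- Jensen's inequality, applied to both exponentials of the expected number of pulls. -/
lemma rpow_le_historyExp (hsel : IsArgmaxRule sel) (T : ℕ) :
    historyExp slowArms t0 sel T (fun h => (33 / 14) ^ pulls h) ^ (regretExponent - 1) ≤
      historyExp slowArms t0 sel T fun h => (2 / 3) ^ pulls h := by
  have hone := historyExp_one (t0 := t0) hsel T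
  have h1 := rpow_historyExp_le slowArms_nonneg hone (b := 33 / 14) (by norm_num) pulls
  have h2 := rpow_historyExp_le slowArms_nonneg hone (b := 2 / 3) (by norm_num) pulls
  refine le_trans ?_ h2
  rw [← rpow_regretExponent_sub_one, ← Real.rpow_mul (by norm_num), mul_comm,
    Real.rpow_mul (by norm_num)]
  exact Real.rpow_le_rpow_of_nonpos (by positivity) h1 (by linarith [regretExponent_lt_one])

lemma expectedBordaRegret_eq_add_sum (hsel : IsArgmaxRule sel) {T : ℕ} (hT : 3 * t0 ≤ T) :
    expectedBordaRegret slowArms 0 t0 sel T = expectedBordaRegret slowArms 0 t0 sel (3 * t0) +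
      ∑ t ∈ Finset.Ico (3 * t0) T, historyExp slowArms t0 sel t fun h =>
        ∑ i, pullProb slowArms t0 sel h i * bordaGap slowArms 0 i := by
  induction T, hT using Nat.le_induction with
  | base => simp
  | succ T hT ih =>
    rw [expectedBordaRegret_succ hsel, ih, Finset.sum_Ico_succ_top hT, add_assoc]

lemma expectedBordaRegret_nonneg (T : ℕ) : 0 ≤ expectedBordaRegret slowArms 0 t0 sel T := by
  refine Finset.sum_nonneg fun h _ => mul_nonneg (historyProb_nonneg slowArms_nonneg h)
    (Finset.sum_nonneg fun t _ => ?_)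
  obtain ⟨g0, g1, g2⟩ := bordaGap_slowArms
  generalize (h t).1 = i
  fin_cases i
  · exact g0.ge
  · exact le_of_le_of_eq (by norm_num) g1.symm
  · exact le_of_le_of_eq (by norm_num) g2.symm

lemma sum_gap (h : Fin 3 → ℝ) : ∑ i, h i * bordaGap slowArms 0 i =
    1 / 26 * h 1 + 10 / 13 * h 2 := by
  obtain ⟨g0, g1, g2⟩ := bordaGap_slowArms
  rw [Fin.sum_univ_three, g0, g1, g2]
  ring

/-- The expected regret of a round is comparable to the expectation of `(2 / 3) ^ pulls`. -/
lemma historyExp_gap_bounds (hsel : IsArgmaxRule sel) {t : ℕ} (ht : 3 * t0 ≤ t) :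
    1 / 936 * historyExp slowArms t0 sel t (fun h => (2 / 3) ^ pulls h) ≤
      historyExp slowArms t0 sel t
        (fun h => ∑ i, pullProb slowArms t0 sel h i * bordaGap slowArms 0 i) ∧
    historyExp slowArms t0 sel t
        (fun h => ∑ i, pullProb slowArms t0 sel h i * bordaGap slowArms 0 i) ≤
      historyExp slowArms t0 sel t fun h => (2 / 3) ^ pulls h := by
  constructor
  · rw [← historyExp_const_mul]
    refine historyExp_mono slowArms_nonneg fun h hh => ?_
    obtain ⟨h2, h3, h4⟩ := count_two_eq_zero hh
    have hp : 1 / 36 * (2 / 3 : ℝ) ^ pulls h ≤ _ := le_pullProb_one_add_two hsel ht h2 h3 h4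
    have hp2 : 0 ≤ pullProb slowArms t0 sel h 2 := pullProb_nonneg _ _ _
    rw [sum_gap]
    linarith
  · refine historyExp_mono slowArms_nonneg fun h hh => ?_
    obtain ⟨h2, h3, h4⟩ := count_two_eq_zero hh
    have hp1 : _ ≤ (2 / 3 : ℝ) ^ pulls h := pullProb_one_le hsel ht h2 h3 h4
    have hp2 : _ ≤ (14 / 33 : ℝ) ^ pulls h := pullProb_two_le hsel ht h2 h3 h4
    have hle : (14 / 33 : ℝ) ^ pulls h ≤ (2 / 3) ^ pulls h :=
      pow_le_pow_left₀ (by norm_num) (by norm_num) _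
    have hnn : (0 : ℝ) ≤ (2 / 3) ^ pulls h := by positivity
    rw [sum_gap]
    linarith

lemma exists_inv_rate_bound (hsel : IsArgmaxRule sel) :
    ∃ K : ℝ, 0 < K ∧ ∀ T : ℕ, 1 ≤ T → ∀ t, 3 * t0 ≤ t → t ≤ T →
      historyExp slowArms t0 sel t (fun h => (33 / 14) ^ pulls h) ≤ K * T := by
  have hA : 0 ≤ historyExp slowArms t0 sel (3 * t0) (fun h => (33 / 14) ^ pulls h) :=
    Finset.sum_nonneg fun h _ => mul_nonneg (historyProb_nonneg slowArms_nonneg h) (by positivity)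
  refine ⟨_ + 2, by positivity, fun T hT t ht htT => (historyExp_inv_rate_le hsel ht).trans ?_⟩
  have hT' : (1 : ℝ) ≤ T := by exact_mod_cast hT
  have htT' : (t : ℝ) ≤ T := by exact_mod_cast htT
  nlinarith

lemma one_le_historyExp_inv_rate (hsel : IsArgmaxRule sel) (t : ℕ) :
    1 ≤ historyExp slowArms t0 sel t (fun h => (33 / 14) ^ pulls h) := by
  rw [← historyExp_one (t0 := t0) hsel t]
  exact historyExp_mono slowArms_nonneg fun h _ => one_le_pow₀ (by norm_num)

lemma exists_mul_rpow_le_expectedBordaRegret (hsel : IsArgmaxRule sel) :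
    ∃ c : ℝ, 0 < c ∧ ∀ᶠ T : ℕ in atTop,
      c * (T : ℝ) ^ regretExponent ≤ expectedBordaRegret slowArms 0 t0 sel T := by
  obtain ⟨K, hK, hbound⟩ := exists_inv_rate_bound (t0 := t0) hsel
  refine ⟨1 / 1872 * K ^ (regretExponent - 1), by positivity, ?_⟩
  filter_upwards [eventually_ge_atTop (6 * t0), eventually_ge_atTop 1] with T hT hT1
  have hT3 : 3 * t0 ≤ T := by omega
  have hTpos : (0 : ℝ) < T := by exact_mod_cast hT1
  have hTcast : (6 * t0 : ℝ) ≤ T := by exact_mod_cast hT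
  have hsum : ∑ _t ∈ Finset.Ico (3 * t0) T, 1 / 936 * (K * T) ^ (regretExponent - 1) ≤
      ∑ t ∈ Finset.Ico (3 * t0) T, historyExp slowArms t0 sel t fun h =>
        ∑ i, pullProb slowArms t0 sel h i * bordaGap slowArms 0 i := by
    refine Finset.sum_le_sum fun t ht => ?_
    obtain ⟨ht0, htT⟩ := Finset.mem_Ico.1 ht
    refine le_trans ?_ (historyExp_gap_bounds hsel ht0).1
    refine mul_le_mul_of_nonneg_left (le_trans ?_ (rpow_le_historyExp hsel t)) (by norm_num)
    exact Real.rpow_le_rpow_of_nonpos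
      (lt_of_lt_of_le one_pos (one_le_historyExp_inv_rate hsel t)) (hbound T hT1 t ht0 htT.le)
      (by linarith [regretExponent_lt_one])
  rw [Finset.sum_const, Nat.card_Ico, nsmul_eq_mul, Nat.cast_sub hT3] at hsum
  rw [expectedBordaRegret_eq_add_sum hsel hT3]
  have hnn := expectedBordaRegret_nonneg (t0 := t0) (sel := sel) (3 * t0)
  have hrw : (T : ℝ) ^ regretExponent = T * (T : ℝ) ^ (regretExponent - 1) := by
    rw [Real.rpow_sub_one hTpos.ne', mul_div_cancel₀ _ hTpos.ne']
  rw [Real.mul_rpow hK.le hTpos.le] at hsum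
  rw [hrw]
  set X := K ^ (regretExponent - 1) * (T : ℝ) ^ (regretExponent - 1) with hX
  have hXnn : 0 ≤ X := by positivity
  have hhalf : (T : ℝ) / 2 ≤ T - (3 * t0 : ℕ) := by
    push_cast
    linarith
  have := mul_le_mul_of_nonneg_right hhalf hXnn
  calc 1 / 1872 * K ^ (regretExponent - 1) * (T * (T : ℝ) ^ (regretExponent - 1))
      = 1 / 936 * (T / 2 * X) := by rw [hX]; ring
    _ ≤ _ := by linarith

lemma exists_expectedBordaRegret_le_mul_rpow (hsel : IsArgmaxRule sel) :
    ∃ C : ℝ, ∀ᶠ T : ℕ in atTop,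
      expectedBordaRegret slowArms 0 t0 sel T ≤ C * (T : ℝ) ^ regretExponent := by
  obtain ⟨K, hK, hbound⟩ := exists_inv_rate_bound (t0 := t0) hsel
  refine ⟨expectedBordaRegret slowArms 0 t0 sel (3 * t0) + 357 / 4 * K ^ regretExponent, ?_⟩
  filter_upwards [eventually_ge_atTop (3 * t0), eventually_ge_atTop 1] with T hT hT1
  have hT' : (1 : ℝ) ≤ T := by exact_mod_cast hT1
  have hsum := Finset.sum_le_sum fun t (ht : t ∈ Finset.Ico (3 * t0) T) =>
    (historyExp_gap_bounds hsel (Finset.mem_Ico.1 ht).1).2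
  have hpot := (sum_historyExp_le hsel hT).trans (historyExp_potential_le hsel T)
  have hpow := Real.rpow_le_rpow
    (zero_le_one.trans (one_le_historyExp_inv_rate (t0 := t0) hsel T)) (hbound T hT1 T hT le_rfl)
    regretExponent_pos.le
  rw [Real.mul_rpow hK.le (zero_le_one.trans hT')] at hpow
  have hone : 1 ≤ (T : ℝ) ^ regretExponent := Real.one_le_rpow hT' regretExponent_pos.le
  have hfirst := mul_le_mul_of_nonneg_left hone
    (expectedBordaRegret_nonneg (t0 := t0) (sel := sel) (3 * t0))
  rw [expectedBordaRegret_eq_add_sum hsel hT]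
  linarith

end Growth

/-- A real sequence that is eventually bounded between two positive constants has a positive real
lower limit. -/
lemma exists_pos_liminf_eq {f : ℕ → ℝ} {c C : ℝ} (hc : 0 < c) (hf : ∀ᶠ n in atTop, c ≤ f n)
    (hC : ∀ᶠ n in atTop, f n ≤ C) :
    ∃ ξ : ℝ, 0 < ξ ∧ liminf (fun n => (f n : EReal)) atTop = (ξ : EReal) := by
  have h1 : (c : EReal) ≤ liminf (fun n => (f n : EReal)) atTop :=
    le_liminf_of_le (by isBoundedDefault) (hf.mono fun n hn => EReal.coe_le_coe_iff.2 hn)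
  have h2 : liminf (fun n => (f n : EReal)) atTop ≤ (C : EReal) :=
    liminf_le_of_frequently_le' (hC.mono fun n hn => EReal.coe_le_coe_iff.2 hn).frequently
  generalize liminf (fun n => (f n : EReal)) atTop = L at h1 h2
  induction L with
  | bot => exact absurd h1 (by simp)
  | top => exact absurd h2 (by simp)
  | coe ξ => exact ⟨ξ, hc.trans_le (EReal.coe_le_coe_iff.1 h1), rfl⟩

end QDB

theorem theorem2 :
    ∃ P : Fin 3 → Fin 5 → ℝ,
      (∀ i, P i ∈ stdSimplex ℝ (Fin 5)) ∧ QDB.IsBordaWinner P 0 ∧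
      ∃ η : ℝ, 0 < η ∧
        ∀ (t0 : ℕ) (sel : (Fin 3 → ℝ) → Fin 3), QDB.IsArgmaxRule sel →
          (∃ ξ : ℝ, 0 < ξ ∧
            liminf (fun T : ℕ =>
              ((QDB.expectedBordaRegret P 0 t0 sel T / (T : ℝ) ^ η : ℝ) : EReal)) atTop
              = (ξ : EReal)) ∧
          (∀ δ : ℝ, 0 < δ → ∀ᶠ T : ℕ in atTop,
            (T : ℝ) ^ ((3 : ℝ) / 32 - δ) ≤ QDB.expectedBordaRegret P 0 t0 sel T) := by
  refine ⟨QDB.slowArms, QDB.slowArms_mem_stdSimplex, QDB.isBordaWinner_slowArms,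
    QDB.regretExponent, QDB.regretExponent_pos, fun t0 sel hsel => ?_⟩
  obtain ⟨c, hc, hlow⟩ := QDB.exists_mul_rpow_le_expectedBordaRegret (t0 := t0) hsel
  obtain ⟨C, hup⟩ := QDB.exists_expectedBordaRegret_le_mul_rpow (t0 := t0) hsel
  refine ⟨QDB.exists_pos_liminf_eq hc ?_ ?_ (C := C), fun δ hδ => ?_⟩
  · filter_upwards [hlow, eventually_gt_atTop 0] with T hT hT0
    exact (le_div_iff₀ (Real.rpow_pos_of_pos (by exact_mod_cast hT0) _)).2 hT
  · filter_upwards [hup, eventually_gt_atTop 0] with T hT hT0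
    exact (div_le_iff₀ (Real.rpow_pos_of_pos (by exact_mod_cast hT0) _)).2 hT
  · have hexp : 0 < QDB.regretExponent - (3 / 32 - δ) := by
      linarith [QDB.half_lt_regretExponent]
    have htend := (tendsto_rpow_atTop hexp).comp (tendsto_natCast_atTop_atTop (R := ℝ))
    filter_upwards [hlow, htend.eventually_ge_atTop c⁻¹, eventually_gt_atTop 0] with T hT hbig hT0
    have hT0' : (0 : ℝ) < T := by exact_mod_cast hT0
    refine le_trans ?_ hT
    have hbig' : 1 ≤ c * (T : ℝ) ^ (QDB.regretExponent - (3 / 32 - δ)) := by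
      rw [← inv_le_iff_one_le_mul₀' hc]
      exact hbig
    calc (T : ℝ) ^ ((3 : ℝ) / 32 - δ) = 1 * (T : ℝ) ^ ((3 : ℝ) / 32 - δ) := (one_mul _).symm
      _ ≤ c * (T : ℝ) ^ (QDB.regretExponent - (3 / 32 - δ)) * (T : ℝ) ^ ((3 : ℝ) / 32 - δ) := by
        gcongr
      _ = c * (T : ℝ) ^ QDB.regretExponent := by
        rw [mul_assoc, ← Real.rpow_add hT0', sub_add_cancel]

end
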